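/- A set of integers is called sum-free if it contains no elements $x, y, z$ (with $x = y$ allowed) such that $x + y = z$. For $n \in \mathbb{N}$ let $[n] = \{1, \dots, n\}$ and let $O_n$ denote the set of odd numbers in $[n]$. There exist absolute constants $\delta_0 > 0$ and $C > 0$ such that, for every $0 < \delta \leqslant \delta_0$ and all integers $m, n \geqslant 1$, there are at most $$2^{C n/m} \binom{\lceil n/2 \rceil}{m}$$ sum-free subsets $I \subset [n]$ with $|I| = m$ and $|I \setminus O_n| \leqslant \delta m$. In particular, if $n$ is even, there are at most $2^{Cn/m}\binom{n/2}{m}$ such sets. -/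

import Mathlib

/-- A finite set of natural numbers is sum-free if it contains no solution of `x + y = z`;
`x` and `y` are allowed to be equal. -/
def IsSumFree (I : Finset ℕ) : Prop :=
  ∀ x ∈ I, ∀ y ∈ I, ∀ z ∈ I, x + y ≠ z

/-- The set of odd numbers in `[n] = {1, …, n}`. -/
def oddsUpTo (n : ℕ) : Finset ℕ :=
  (Finset.Icc 1 n).filter Odd

open Classical in
/-- The family of sum-free `m`-subsets `I` of `[n] = {1, …, n}` that have at most `δ * m`
elements outside the set of odd numbers. -/
noncomputable def sumFreeFewEven (n m : ℕ) (δ : ℝ) : Finset (Finset ℕ) :=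
  ((Finset.Icc 1 n).powersetCard m).filter fun I =>
    IsSumFree I ∧ ((I \ oddsUpTo n).card : ℝ) ≤ δ * m

open Finset

/-! Fix the even part `S` of `I`, with `k` elements. Sum-freeness makes the odd part independent in
the digraph on the `N = ⌈n/2⌉` odd numbers with arcs `v → |s - v|`, `s ∈ S`, whose out-degrees are
at least `k/2` and in-degrees at most `2k`. In such a digraph most sets of about `r/4` vertices have
at least `min(N/16, kr/512)` out-neighbours, all avoided by any independent `r`-set containing them.
So (`card_independent_le`) at most a fraction `2e^(-r/128) + e^(-kr²/(1024N))` of the `r`-sets is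
independent. When summing over `S`, `choose_mul_choose_sub_le` bounds the choices by `choose m k *
4^k` times the target binomial. The first term stays bounded because `k ≤ δm`; the second sums to
`e^(O(N/m))`. This needs `4m ≤ 3N` and `m ≥ 8`; otherwise no even element fits
(`card_sumFreeFewEven_le_choose`). -/

/-! ### Neighbourhoods of random sets in a digraph. -/

/-- Under an in-degree bound, few vertices have a large part of their neighbourhood in `U`. -/
theorem card_mostly_covered_le {α : Type*} [DecidableEq α] {V : Finset α} {nb : α → Finset α}
    {k : ℕ} (hk : 0 < k) (hin : ∀ w ∈ V, #{v ∈ V | w ∈ nb v} ≤ 2 * k)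
    {U : Finset α} (hU : U ⊆ V) :
    #{v ∈ V | k < 4 * #(nb v ∩ U)} ≤ 8 * #U := by
  have h1 : ∑ v ∈ V, #(nb v ∩ U) = ∑ u ∈ U, #{v ∈ V | u ∈ nb v} := by
    simpa only [bipartiteAbove, bipartiteBelow, filter_mem_eq_inter, inter_comm] using
      Finset.sum_card_bipartiteAbove_eq_sum_card_bipartiteBelow
        (s := V) (t := U) (fun v u => u ∈ nb v)
  have h2 : ∑ u ∈ U, #{v ∈ V | u ∈ nb v} ≤ #U * (2 * k) :=
    Finset.sum_le_card_nsmul _ _ _ fun u hu => hin u (hU hu)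
  have h3 : #{v ∈ V | k < 4 * #(nb v ∩ U)} * k ≤ 4 * ∑ v ∈ V, #(nb v ∩ U) := by
    rw [Finset.mul_sum]
    calc _ = ∑ v ∈ V with k < 4 * #(nb v ∩ U), k := by simp
      _ ≤ ∑ v ∈ V with k < 4 * #(nb v ∩ U), 4 * #(nb v ∩ U) :=
        Finset.sum_le_sum fun v hv => (Finset.mem_filter.1 hv).2.le
      _ ≤ _ := Finset.sum_le_sum_of_subset (Finset.filter_subset _ _)
  rw [h1] at h3
  refine Nat.le_of_mul_le_mul_right (?_ : _ * k ≤ _ * k) hk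
  linarith

/-- Double counting of a set with one marked element: a random set grows by one vertex, which drives
the induction on `j` below. -/
theorem sum_powersetCard_succ {α M : Type*} [DecidableEq α] [AddCommMonoid M] (V : Finset α)
    (j : ℕ) (f : Finset α → M) :
    ∑ R ∈ V.powersetCard (j + 1), (j + 1) • f R =
      ∑ R ∈ V.powersetCard j, ∑ v ∈ V \ R, f (insert v R) := by
  have : ∑ R ∈ V.powersetCard (j + 1), (j + 1) • f R =
      ∑ R ∈ V.powersetCard (j + 1), ∑ _v ∈ R, f R :=
    Finset.sum_congr rfl fun R hR => by simp [(Finset.mem_powersetCard.1 hR).2]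
  rw [this, Finset.sum_sigma', Finset.sum_sigma']
  refine Finset.sum_bij' (fun p _ => ⟨p.1.erase p.2, p.2⟩) (fun p _ => ⟨insert p.2 p.1, p.2⟩)
    ?_ ?_ ?_ ?_ ?_
  · rintro ⟨R, v⟩ h
    simp only [mem_sigma, mem_powersetCard, mem_sdiff, mem_erase] at h ⊢
    obtain ⟨⟨h1, h2⟩, h3⟩ := h
    exact ⟨⟨(erase_subset _ _).trans h1, by rw [card_erase_of_mem h3, h2]; rfl⟩, h1 h3, by simp⟩
  · rintro ⟨R, v⟩ h
    simp only [mem_sigma, mem_powersetCard, mem_sdiff] at h ⊢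
    obtain ⟨⟨h1, h2⟩, h3, h4⟩ := h
    exact ⟨⟨insert_subset h3 h1, by rw [card_insert_of_notMem h4, h2]⟩, mem_insert_self _ _⟩
  · rintro ⟨R, v⟩ h
    simp only [mem_sigma] at h
    simp [insert_erase h.2]
  · rintro ⟨R, v⟩ h
    simp only [mem_sigma, mem_sdiff] at h
    simp [erase_insert h.2.2]
  · rintro ⟨R, v⟩ h
    simp only [mem_sigma] at h
    simp [insert_erase h.2]

section Expansion

variable {α : Type*} [DecidableEq α] {V : Finset α} {nb : α → Finset α} {k : ℕ}

/-- A vertex that is not mostly covered brings at least `k/2 - k/4` new neighbours, so the weight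
drops by a factor `e⁻¹ ≤ 1/2`. The mostly covered ones number at most `8|U| < |V|/2`, under three
quarters of `V \ R`, so the average factor is at most `7/8`. -/
theorem sum_exp_neg_card_biUnion_insert_le (hk : 0 < k) (hsub : ∀ v ∈ V, nb v ⊆ V)
    (hdeg : ∀ v ∈ V, k ≤ 2 * #(nb v)) (hin : ∀ w ∈ V, #{v ∈ V | w ∈ nb v} ≤ 2 * k)
    {R : Finset α} (hR : R ⊆ V) (hRV : 4 * #R ≤ #V) (hN : 16 * #(R.biUnion nb) < #V) :
    ∑ v ∈ V \ R, Real.exp (-(4 * #((insert v R).biUnion nb) / k)) ≤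
      7 / 8 * (#V - #R) * Real.exp (-(4 * #(R.biUnion nb) / k)) := by
  set U := R.biUnion nb with hUdef
  have hU : U ⊆ V := Finset.biUnion_subset.2 fun v hv => hsub v (hR hv)
  set w := Real.exp (-(4 * #U / k)) with hw
  have hk' : (0 : ℝ) < k := by exact_mod_cast hk
  have hw0 : 0 < w := Real.exp_pos _
  set B := {v ∈ V | k < 4 * #(nb v ∩ U)} with hB
  have hBc : #B ≤ 8 * #U := card_mostly_covered_le hk hin hU
  have hsdiff : #(V \ R) = #V - #R := card_sdiff_of_subset hR
  have hkey : ∀ v ∈ V \ R, Real.exp (-(4 * #((insert v R).biUnion nb) / k)) ≤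
      (if v ∈ B then w else w / 2) := by
    intro v hv
    rw [Finset.biUnion_insert]
    have hc : #(nb v ∪ U) + #(nb v ∩ U) = #(nb v) + #U := card_union_add_card_inter _ _
    split_ifs with h
    · refine Real.exp_le_exp.2 (neg_le_neg ?_)
      have : #U ≤ #(nb v ∪ U) := card_le_card subset_union_right
      gcongr
    · have hvV := (mem_sdiff.1 hv).1
      have h4 : 4 * #(nb v ∩ U) ≤ k := by simpa [hB, hvV] using h
      have hd := hdeg v hvV
      have h5 : k + 4 * #U ≤ 4 * #(nb v ∪ U) := by omega
      have h6 : (k : ℝ) + 4 * #U ≤ 4 * #(nb v ∪ U) := by exact_mod_cast h5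
      have h7 : Real.exp (-(4 * #(nb v ∪ U) / k)) ≤ Real.exp (-1 + -(4 * #U / k)) := by
        refine Real.exp_le_exp.2 ?_
        have : (k + 4 * #U : ℝ) / k ≤ 4 * #(nb v ∪ U) / k := by gcongr
        rw [add_div, div_self hk'.ne'] at this
        linarith
      refine h7.trans ?_
      rw [Real.exp_add, ← hw]
      have h8 : Real.exp (-1) ≤ 1 / 2 := by
        rw [Real.exp_neg, one_div]
        exact inv_anti₀ (by norm_num) (by linarith [Real.add_one_le_exp 1])
      nlinarith
  refine (Finset.sum_le_sum hkey).trans ?_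
  have hsum : ∑ v ∈ V \ R, (if v ∈ B then w else w / 2) =
      ∑ v ∈ V \ R, (w / 2 + if v ∈ B then w / 2 else 0) := by
    refine Finset.sum_congr rfl fun v _ => ?_
    split_ifs <;> ring
  rw [hsum, Finset.sum_add_distrib, ← Finset.sum_filter, Finset.sum_const, Finset.sum_const,
    nsmul_eq_mul, nsmul_eq_mul]
  have h9 : (#{v ∈ V \ R | v ∈ B} : ℝ) ≤ #B :=
    by exact_mod_cast card_le_card fun v hv => (mem_filter.1 hv).2
  have h10 : (#(V \ R) : ℝ) = #V - #R := by
    rw [hsdiff, Nat.cast_sub (card_le_card hR)]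
  have h11 : (#B : ℝ) ≤ 8 * #U := by exact_mod_cast hBc
  have h12 : (16 * #U : ℝ) < #V := by exact_mod_cast hN
  have h13 : (4 * #R : ℝ) ≤ #V := by exact_mod_cast hRV
  rw [h10]
  have : ((#V - #R : ℝ) + #{v ∈ V \ R | v ∈ B}) / 2 ≤ 7 / 8 * (#V - #R) := by linarith
  nlinarith

theorem sum_exp_neg_card_biUnion_le (hk : 0 < k) (hsub : ∀ v ∈ V, nb v ⊆ V)
    (hdeg : ∀ v ∈ V, k ≤ 2 * #(nb v)) (hin : ∀ w ∈ V, #{v ∈ V | w ∈ nb v} ≤ 2 * k)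
    {j : ℕ} (hj : 4 * j ≤ #V) :
    ∑ R ∈ V.powersetCard j with 16 * #(R.biUnion nb) < #V,
      Real.exp (-(4 * #(R.biUnion nb) / k)) ≤ (#V).choose j * (7 / 8 : ℝ) ^ j := by
  rw [Finset.sum_filter]
  induction j with
  | zero => simp; split_ifs <;> norm_num
  | succ j ih =>
    have ih := ih (by omega)
    set f : Finset α → ℝ := fun R =>
      if 16 * #(R.biUnion nb) < #V then Real.exp (-(4 * #(R.biUnion nb) / k)) else 0 with hf
    have hstep : ∀ R ∈ V.powersetCard j,
        ∑ v ∈ V \ R, f (insert v R) ≤ 7 / 8 * (#V - j) * f R := by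
      intro R hR
      obtain ⟨hRV, rfl⟩ := mem_powersetCard.1 hR
      by_cases hs : 16 * #(R.biUnion nb) < #V
      · simp only [hf, if_pos hs]
        refine le_trans (Finset.sum_le_sum fun v _ => ?_)
          (sum_exp_neg_card_biUnion_insert_le hk hsub hdeg hin hRV (by omega) hs)
        split_ifs
        · exact le_rfl
        · positivity
      -- Neighbourhoods only grow, so a truncated weight that is zero stays zero.
      · simp only [hf, if_neg hs, mul_zero]
        refine Finset.sum_nonpos fun v _ => ?_
        have : #(R.biUnion nb) ≤ #((insert v R).biUnion nb) :=
          card_le_card (biUnion_subset_biUnion_of_subset_left _ (subset_insert _ _))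
        rw [if_neg (by omega)]
    have h1 := sum_powersetCard_succ V j f
    simp only [nsmul_eq_mul] at h1
    rw [← Finset.mul_sum] at h1
    have h2 := (h1.le.trans (Finset.sum_le_sum hstep))
    rw [← Finset.mul_sum] at h2
    have hjV : (j : ℝ) ≤ #V := by exact_mod_cast (by omega : j ≤ #V)
    have h3 : ((#V).choose (j + 1) : ℝ) * (j + 1) = (#V).choose j * (#V - j) := by
      have := Nat.choose_succ_right_eq (#V) j
      rw [← Nat.cast_sub (by omega)]
      exact_mod_cast this
    have h4 : ((j + 1 : ℕ) : ℝ) * ∑ R ∈ V.powersetCard (j + 1), f R ≤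
        7 / 8 * (#V - j) * ((#V).choose j * (7 / 8 : ℝ) ^ j) :=
      h2.trans (mul_le_mul_of_nonneg_left ih (by nlinarith))
    have hj0 : (0 : ℝ) < j + 1 := by positivity
    push_cast at h4
    refine le_of_mul_le_mul_left (h4.trans_eq ?_) hj0
    rw [pow_succ]
    linear_combination (-(7 / 8 : ℝ) ^ j * (7 / 8)) * h3

/-- Few `j`-sets have a small neighbourhood. -/
theorem card_small_biUnion_le (hk : 0 < k) (hsub : ∀ v ∈ V, nb v ⊆ V)
    (hdeg : ∀ v ∈ V, k ≤ 2 * #(nb v)) (hin : ∀ w ∈ V, #{v ∈ V | w ∈ nb v} ≤ 2 * k)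
    {j : ℕ} (hj : 4 * j ≤ #V) :
    (#{R ∈ V.powersetCard j | 16 * #(R.biUnion nb) < #V ∧ 64 * #(R.biUnion nb) < k * j} : ℝ) ≤
      (#V).choose j * Real.exp (-(j / 16)) := by
  have hk' : (0 : ℝ) < k := by exact_mod_cast hk
  have h1 := sum_exp_neg_card_biUnion_le hk hsub hdeg hin hj
  set T := {R ∈ V.powersetCard j | 16 * #(R.biUnion nb) < #V ∧ 64 * #(R.biUnion nb) < k * j}
    with hT
  have h2 : (#T : ℝ) * Real.exp (-(j / 16)) ≤
      ∑ R ∈ V.powersetCard j with 16 * #(R.biUnion nb) < #V,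
        Real.exp (-(4 * #(R.biUnion nb) / k)) := by
    rw [← nsmul_eq_mul, ← Finset.sum_const]
    refine (Finset.sum_le_sum fun R hR => ?_).trans
      (Finset.sum_le_sum_of_subset_of_nonneg (s := T) ?_ fun _ _ _ => (Real.exp_pos _).le)
    · refine Real.exp_le_exp.2 (neg_le_neg ?_)
      have : (64 * #(R.biUnion nb) : ℝ) < k * j := by exact_mod_cast (mem_filter.1 hR).2.2
      rw [div_le_iff₀ hk']
      linarith
    · intro R hR
      simp only [hT, mem_filter] at hR ⊢
      exact ⟨hR.1, hR.2.1⟩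
  -- Markov's inequality: half of the decay `e^(-j/8)` pays for the threshold `kj/64`.
  have h3 : (7 / 8 : ℝ) ^ j ≤ Real.exp (-(j / 16)) * Real.exp (-(j / 16)) := by
    have : (7 / 8 : ℝ) ≤ Real.exp (-(1 / 8)) := by linarith [Real.add_one_le_exp (-(1 / 8 : ℝ))]
    refine (pow_le_pow_left₀ (by norm_num) this j).trans_eq ?_
    rw [← Real.exp_nat_mul, ← Real.exp_add]
    ring_nf
  refine le_of_mul_le_mul_right ?_ (Real.exp_pos (-(j / 16 : ℝ)))
  calc _ ≤ ((#V).choose j : ℝ) * (7 / 8 : ℝ) ^ j := h2.trans h1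
    _ ≤ _ := by rw [mul_assoc]; gcongr

end Expansion

/-! ### Counting independent sets. -/

/-- Each ratio `(a - b - i)/(a - i)` is at most `1 - b/a ≤ e^(-b/a)`. -/
theorem choose_sub_le_mul_exp {a b : ℕ} (hab : b ≤ a) (t : ℕ) :
    ((a - b).choose t : ℝ) ≤ a.choose t * Real.exp (-(b * t / a)) := by
  induction t with
  | zero => simp
  | succ t ih =>
    rcases le_or_gt (a - b) t with h | h
    · rw [Nat.choose_eq_zero_of_lt (by omega)]
      simp only [Nat.cast_zero]
      positivity
    have ha : (0 : ℝ) < a := by exact_mod_cast (by omega : 0 < a)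
    have h1 : ((a - b).choose (t + 1) : ℝ) * (t + 1) = (a - b).choose t * (a - b - t) := by
      have := Nat.choose_succ_right_eq (a - b) t
      rw [← Nat.cast_sub hab, ← Nat.cast_sub h.le]
      exact_mod_cast this
    have h2 : (a.choose (t + 1) : ℝ) * (t + 1) = a.choose t * (a - t) := by
      have := Nat.choose_succ_right_eq a t
      rw [← Nat.cast_sub (by omega)]
      exact_mod_cast this
    have h3 : (a - b - t : ℝ) ≤ (a - t) * Real.exp (-(b / a)) := by
      have h4 : 1 - (b / a : ℝ) ≤ Real.exp (-(b / a)) := by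
        linarith [Real.add_one_le_exp (-(b / a : ℝ))]
      have h5 : (0 : ℝ) ≤ a - t := by
        rw [sub_nonneg]; exact_mod_cast (by omega : t ≤ a)
      refine le_trans ?_ (mul_le_mul_of_nonneg_left h4 h5)
      have h6 : (a - t : ℝ) * (1 - b / a) = a - b - t + t * b / a := by field_simp; ring
      rw [h6]
      have : (0 : ℝ) ≤ t * b / a := by positivity
      linarith
    have h7 : Real.exp (-(b * (t + 1 : ℕ) / a : ℝ)) =
        Real.exp (-(b * t / a)) * Real.exp (-(b / a)) := by
      rw [← Real.exp_add]; push_cast; ring_nf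
    have h8 : (0 : ℝ) ≤ a - b - t := by
      rw [← Nat.cast_sub hab, ← Nat.cast_sub h.le]; positivity
    refine le_of_mul_le_mul_right ?_ (by positivity : (0 : ℝ) < t + 1)
    calc _ = ((a - b).choose t : ℝ) * (a - b - t) := h1
      _ ≤ (a.choose t * Real.exp (-(b * t / a))) * ((a - t) * Real.exp (-(b / a))) := by
        gcongr
      _ = _ := by rw [h7]; linear_combination (-Real.exp (-(b * t / a)) * Real.exp (-(b / a))) * h2

section Independent

variable {α : Type*} [DecidableEq α] {V : Finset α} {nb : α → Finset α} {k : ℕ}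

/-- The number of ways to extend `R` to an independent `r`-set. -/
theorem card_extensions_le (hsub : ∀ v ∈ V, nb v ⊆ V) {r j : ℕ} {R : Finset α}
    (hR : R ∈ V.powersetCard j) :
    (#{I ∈ {I ∈ V.powersetCard r | Disjoint I (I.biUnion nb)} | R ⊆ I} : ℝ) ≤
      (#V - j).choose (r - j) * Real.exp (-(#(R.biUnion nb) * (r - j : ℕ) / (#V - j : ℕ))) := by
  obtain ⟨hRV, rfl⟩ := mem_powersetCard.1 hR
  rcases Finset.eq_empty_or_nonempty
    {I ∈ {I ∈ V.powersetCard r | Disjoint I (I.biUnion nb)} | R ⊆ I} with h | ⟨J, hJ⟩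
  · rw [h]
    simp only [card_empty, Nat.cast_zero]
    positivity
  simp only [mem_filter, mem_powersetCard] at hJ
  have hdis : Disjoint R (R.biUnion nb) :=
    hJ.1.2.mono hJ.2 (biUnion_subset_biUnion_of_subset_left _ hJ.2)
  have hU : R.biUnion nb ⊆ V := Finset.biUnion_subset.2 fun v hv => hsub v (hRV hv)
  have hUR : R.biUnion nb ⊆ V \ R := subset_sdiff.2 ⟨hU, hdis.symm⟩
  have hVR : #(V \ R) = #V - #R := card_sdiff_of_subset hRV
  refine le_trans ?_ (choose_sub_le_mul_exp (hVR ▸ card_le_card hUR) (r - #R))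
  rw [← hVR, ← card_sdiff_of_subset hUR, ← card_powersetCard]
  refine Nat.cast_le.2 (card_le_card_of_injOn (fun I => I \ R) ?_ ?_)
  · intro I hI
    simp only [coe_filter, mem_filter, mem_powersetCard, Set.mem_ofPred_eq] at hI
    obtain ⟨⟨⟨hIV, rfl⟩, hI⟩, hRI⟩ := hI
    simp only [mem_coe, mem_powersetCard]
    refine ⟨subset_sdiff.2 ⟨sdiff_subset_sdiff hIV le_rfl, ?_⟩, card_sdiff_of_subset hRI⟩
    exact hI.mono sdiff_subset (biUnion_subset_biUnion_of_subset_left _ hRI)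
  · intro I hI J hJ h
    simp only [coe_filter, Set.mem_ofPred_eq] at hI hJ
    have h : I \ R = J \ R := h
    rw [← sdiff_union_of_subset hI.2, h, sdiff_union_of_subset hJ.2]

/-- If all out-degrees are at least `k / 2` and all in-degrees are at most `2 * k`, then a random
`r`-set is unlikely to be independent. -/
theorem card_independent_le (hk : 0 < k) (hsub : ∀ v ∈ V, nb v ⊆ V)
    (hdeg : ∀ v ∈ V, k ≤ 2 * #(nb v)) (hin : ∀ w ∈ V, #{v ∈ V | w ∈ nb v} ≤ 2 * k)
    {r : ℕ} (hr : 4 ≤ r) (hrV : r ≤ #V) :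
    (#{I ∈ V.powersetCard r | Disjoint I (I.biUnion nb)} : ℝ) ≤
      (#V).choose r * (2 * Real.exp (-(r / 128)) + Real.exp (-(k * r ^ 2 / (1024 * #V)))) := by
  set j := r / 4 with hj
  set A := {I ∈ V.powersetCard r | Disjoint I (I.biUnion nb)} with hA
  set E : ℝ := Real.exp (-(r / 128)) + Real.exp (-(k * r ^ 2 / (1024 * #V))) with hE
  have hjr : j ≤ r := by omega
  have hV0 : (0 : ℝ) < #V := by exact_mod_cast (by omega : 0 < #V)
  have hj8 : (r : ℝ) / 8 ≤ j := by
    rw [div_le_iff₀ (by norm_num)]; exact_mod_cast (by omega : r ≤ j * 8)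
  have hrj : (r : ℝ) / 2 ≤ (r - j : ℕ) := by
    rw [div_le_iff₀ (by norm_num)]; exact_mod_cast (by omega : r ≤ (r - j) * 2)
  have hsum : #A * r.choose j = ∑ R ∈ V.powersetCard j, #{I ∈ A | R ⊆ I} := by
    have h1 := Finset.sum_card_bipartiteAbove_eq_sum_card_bipartiteBelow
      (s := V.powersetCard j) (t := A) (fun R I => R ⊆ I)
    simp only [bipartiteAbove, bipartiteBelow] at h1
    rw [h1, ← smul_eq_mul, ← Finset.sum_const]
    refine Finset.sum_congr rfl fun I hI => ?_
    obtain ⟨hIV, hIr⟩ := mem_powersetCard.1 (mem_filter.1 hI).1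
    rw [← hIr, ← card_powersetCard]
    congr 1
    ext R
    simp only [mem_powersetCard, mem_filter]
    exact ⟨fun h => ⟨⟨h.1.trans hIV, h.2⟩, h.1⟩, fun h => ⟨h.2, h.1.2⟩⟩
  set P : Finset α → Prop :=
    fun R => 16 * #(R.biUnion nb) < #V ∧ 64 * #(R.biUnion nb) < k * j with hP
  have hterm : ∀ R ∈ V.powersetCard j, (#{I ∈ A | R ⊆ I} : ℝ) ≤
      (#V - j).choose (r - j) * ((if P R then 1 else 0) + E) := by
    intro R hR
    refine (card_extensions_le hsub hR).trans (mul_le_mul_of_nonneg_left ?_ (by positivity))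
    have hE0 : 0 ≤ E := by positivity
    split_ifs with h
    · have : Real.exp (-(#(R.biUnion nb) * (r - j : ℕ) / (#V - j : ℕ) : ℝ)) ≤ 1 :=
        Real.exp_le_one_iff.2 (neg_nonpos.2 (by positivity))
      linarith
    rw [zero_add]
    have hVj : (0 : ℝ) < (#V - j : ℕ) := by exact_mod_cast (by omega : 0 < #V - j)
    have hVj' : ((#V - j : ℕ) : ℝ) ≤ #V := by exact_mod_cast Nat.sub_le _ _
    have h0 : (#(R.biUnion nb) * (r / 2) / #V : ℝ) ≤
        #(R.biUnion nb) * (r - j : ℕ) / (#V - j : ℕ) := by gcongr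
    -- At least `|V|/16` neighbours give exponent `r/32`; at least `kj/64 ≥ kr/512` give
    -- `kr²/(1024|V|)`.
    rcases not_and_or.1 h with h | h
    · have h' : (#V : ℝ) ≤ 16 * #(R.biUnion nb) := by exact_mod_cast not_lt.1 h
      refine le_trans (Real.exp_le_exp.2 (neg_le_neg (le_trans ?_ h0)))
        (le_add_of_nonneg_right (Real.exp_pos _).le)
      rw [le_div_iff₀ hV0]
      have : (0 : ℝ) ≤ r := by positivity
      nlinarith
    · have h' : (k * j : ℝ) ≤ 64 * #(R.biUnion nb) := by exact_mod_cast not_lt.1 h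
      refine le_trans (Real.exp_le_exp.2 (neg_le_neg (le_trans ?_ h0)))
        (le_add_of_nonneg_left (Real.exp_pos _).le)
      have h2 : (k * (r / 8) : ℝ) ≤ 64 * #(R.biUnion nb) := le_trans (by gcongr) h'
      have h3 : (k * r ^ 2 / (1024 * #V) : ℝ) = (k * (r / 8) / 64) * (r / 2) / #V := by
        field_simp; norm_num
      rw [h3]
      gcongr
      linarith
  have hbad : (#{R ∈ V.powersetCard j | P R} : ℝ) ≤ (#V).choose j * Real.exp (-(r / 128)) := by
    refine (card_small_biUnion_le hk hsub hdeg hin (by omega)).trans ?_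
    refine mul_le_mul_of_nonneg_left (Real.exp_le_exp.2 ?_) (by positivity)
    have : (0 : ℝ) ≤ r := by positivity
    linarith
  have hch : ((#V).choose r : ℝ) * r.choose j = (#V).choose j * (#V - j).choose (r - j) := by
    exact_mod_cast Nat.choose_mul hjr
  have hrj0 : (0 : ℝ) < r.choose j := by exact_mod_cast Nat.choose_pos hjr
  refine le_of_mul_le_mul_right ?_ hrj0
  calc (#A : ℝ) * r.choose j = ∑ R ∈ V.powersetCard j, (#{I ∈ A | R ⊆ I} : ℝ) := by
        exact_mod_cast hsum
    _ ≤ ∑ R ∈ V.powersetCard j, (#V - j).choose (r - j) * ((if P R then 1 else 0) + E) :=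
        Finset.sum_le_sum hterm
    _ = (#V - j).choose (r - j) * (#{R ∈ V.powersetCard j | P R} + (#V).choose j * E) := by
        rw [← Finset.mul_sum, Finset.sum_add_distrib, Finset.sum_boole, Finset.sum_const,
          card_powersetCard, nsmul_eq_mul]
    _ ≤ (#V - j).choose (r - j) *
        ((#V).choose j * Real.exp (-(r / 128)) + (#V).choose j * E) := by gcongr
    _ = _ := by
        rw [hE]
        linear_combination
          (-(2 * Real.exp (-(r / 128)) + Real.exp (-(k * r ^ 2 / (1024 * #V))))) * hch

end Independent

/-! ### The distance digraph on the odd numbers. -/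

theorem mem_oddsUpTo {n x : ℕ} : x ∈ oddsUpTo n ↔ (1 ≤ x ∧ x ≤ n) ∧ x % 2 = 1 := by
  simp [oddsUpTo, Nat.odd_iff]

theorem card_oddsUpTo (n : ℕ) : #(oddsUpTo n) = (n + 1) / 2 := by
  have : oddsUpTo n = (range ((n + 1) / 2)).image fun i => 2 * i + 1 := by
    ext x
    simp only [mem_oddsUpTo, mem_image, mem_range]
    exact ⟨fun h => ⟨x / 2, by omega, by omega⟩, by rintro ⟨i, h, rfl⟩; omega⟩
  rw [this, card_image_of_injective _ fun a b h => by simpa using h, card_range]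

/-- The distances from `v` to the elements of `S`. -/
def distances (S : Finset ℕ) (v : ℕ) : Finset ℕ :=
  -- One truncated difference vanishes, so the sum is `|s - v|`.
  S.image fun s => (s - v) + (v - s)

section Distances

variable {n : ℕ} {S : Finset ℕ}

theorem mem_evens {s : ℕ} : s ∈ Icc 1 n \ oddsUpTo n ↔ (1 ≤ s ∧ s ≤ n) ∧ s % 2 = 0 := by
  simp only [mem_sdiff, mem_Icc, mem_oddsUpTo]
  omega

theorem distances_subset (hS : S ⊆ Icc 1 n \ oddsUpTo n) {v : ℕ} (hv : v ∈ oddsUpTo n) :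
    distances S v ⊆ oddsUpTo n := by
  intro w hw
  obtain ⟨s, hs, rfl⟩ := mem_image.1 hw
  have hs := mem_evens.1 (hS hs)
  rw [mem_oddsUpTo] at hv ⊢
  omega

/-- A distance `d` from `v` is attained only at `v ± d`. -/
theorem card_le_two_mul_card_image_dist (S : Finset ℕ) (v : ℕ) :
    #S ≤ 2 * #(S.image fun s => (s - v) + (v - s)) := by
  refine card_le_mul_card_image S 2 fun a _ => ?_
  refine (card_le_card (t := {v + a, v - a}) fun s hs => ?_).trans card_le_two
  simp only [mem_filter, mem_insert, mem_singleton] at hs ⊢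
  omega

theorem card_mem_distances_le (O : Finset ℕ) (w : ℕ) :
    #{v ∈ O | w ∈ distances S v} ≤ 2 * #S := by
  have : {v ∈ O | w ∈ distances S v} ⊆
      S.image (fun s => s + w) ∪ S.image (fun s => s - w) := by
    intro v hv
    simp only [distances, mem_filter, mem_union, mem_image] at hv ⊢
    obtain ⟨-, s, hs, h⟩ := hv
    rcases le_total s v with h' | h'
    · exact Or.inl ⟨s, hs, by omega⟩
    · exact Or.inr ⟨s, hs, by omega⟩
  refine (card_le_card this).trans ((card_union_le _ _).trans ?_)
  linarith [card_image_le (s := S) (f := fun s => s + w),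
    card_image_le (s := S) (f := fun s => s - w)]

/-- An arc `v → w` within `I` would give `w + s = v` or `w + v = s`. -/
theorem IsSumFree.disjoint_distances {I : Finset ℕ} (hI : IsSumFree I) (O : Finset ℕ) :
    Disjoint (I ∩ O) ((I ∩ O).biUnion (distances (I \ O))) := by
  rw [disjoint_left]
  intro w hw hw'
  simp only [mem_biUnion, distances, mem_image] at hw'
  obtain ⟨v, hv, s, hs, h⟩ := hw'
  have hw := (mem_inter.1 hw).1
  have hv := (mem_inter.1 hv).1
  have hs := (mem_sdiff.1 hs).1
  rcases le_total s v with h' | h'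
  · exact hI w hw s hs v hv (by omega)
  · exact hI w hw v hv s hs (by omega)

/-- A sum-free set with an even element contains at most two thirds of the odd numbers. -/
theorem IsSumFree.three_mul_card_odds_le {I : Finset ℕ} (hI : IsSumFree I)
    (hIn : I ⊆ Icc 1 n) (hne : (I \ oddsUpTo n).Nonempty) :
    3 * #(I ∩ oddsUpTo n) ≤ 2 * #(oddsUpTo n) := by
  obtain ⟨s, hs⟩ := hne
  have hdis := hI.disjoint_distances (oddsUpTo n)
  have himg : (I ∩ oddsUpTo n).image (fun v => (v - s) + (s - v)) ⊆
      (I ∩ oddsUpTo n).biUnion (distances (I \ oddsUpTo n)) := by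
    intro w hw
    obtain ⟨v, hv, rfl⟩ := mem_image.1 hw
    exact mem_biUnion.2 ⟨v, hv, mem_image.2 ⟨s, hs, by ring⟩⟩
  have hsub : (I ∩ oddsUpTo n).biUnion (distances (I \ oddsUpTo n)) ⊆ oddsUpTo n :=
    biUnion_subset.2 fun v hv =>
      distances_subset (sdiff_subset_sdiff hIn le_rfl) (mem_inter.1 hv).2
  -- The distances to one even `s` are odd, lie outside `I`, and number at least half of `I ∩
  -- oddsUpTo n`.
  have h1 := card_le_two_mul_card_image_dist (I ∩ oddsUpTo n) s
  have h2 := card_le_card (union_subset (inter_subset_right (s₁ := I)) (himg.trans hsub))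
  rw [card_union_of_disjoint (hdis.mono_right himg)] at h2
  omega

end Distances

/-! ### Binomial estimates. -/

/-- Raising the upper index to `a` costs `a/(a - t) ≤ 4` while `t ≤ 3a/4`. -/
theorem choose_add_le_four_pow_mul {M t : ℕ} :
    ∀ {k : ℕ}, 4 * (t + k) ≤ 3 * (M + k) → (M + k).choose t ≤ 4 ^ k * M.choose t
  | 0, _ => by simp
  | k + 1, h => by
    have ih := choose_add_le_four_pow_mul (M := M) (t := t) (k := k) (by omega)
    have h1 := Nat.choose_mul_succ_eq (M + k) t
    have h2 : M + k + 1 ≤ 4 * (M + k + 1 - t) := by omega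
    have h3 : (M + k + 1).choose t ≤ 4 * (M + k).choose t := by
      refine Nat.le_of_mul_le_mul_right (?_ : _ * (M + k + 1) ≤ _ * (M + k + 1)) (by omega)
      calc _ ≤ (M + k + 1).choose t * (4 * (M + k + 1 - t)) := Nat.mul_le_mul_left _ h2
        _ = _ := by rw [mul_assoc, h1]; ring
    calc _ ≤ 4 * (M + k).choose t := h3
      _ ≤ 4 * (4 ^ k * M.choose t) := Nat.mul_le_mul_left _ ih
      _ = _ := by ring

theorem choose_mul_choose_sub_le {N m k : ℕ} (hkm : k ≤ m) (hmN : 4 * m ≤ 3 * N) :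
    N.choose k * N.choose (m - k) ≤ N.choose m * (m.choose k * 4 ^ k) := by
  obtain ⟨M, rfl⟩ := Nat.exists_eq_add_of_le' (by omega : k ≤ N)
  have h1 := choose_add_le_four_pow_mul (M := M) (t := m - k) (k := k) (by omega)
  have h2 := Nat.choose_mul (n := M + k) hkm
  rw [Nat.add_sub_cancel] at h2
  calc _ ≤ (M + k).choose k * (4 ^ k * M.choose (m - k)) := Nat.mul_le_mul_left _ h1
    _ = 4 ^ k * ((M + k).choose k * M.choose (m - k)) := by ring
    _ = _ := by rw [← h2]; ring

theorem sum_choose_mul_pow_le (m : ℕ) {y : ℝ} (hy : 0 ≤ y) :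
    ∑ k ∈ range (m + 1), (m.choose k : ℝ) * y ^ k ≤ Real.exp (m * y) := by
  have h := add_pow y 1 m
  simp only [one_pow, mul_one] at h
  calc _ = (y + 1) ^ m := by rw [h]; exact Finset.sum_congr rfl fun _ _ => mul_comm _ _
    _ ≤ Real.exp y ^ m := pow_le_pow_left₀ (by linarith) (Real.add_one_le_exp y) m
    _ = _ := (Real.exp_nat_mul y m).symm

/-- The lower part of the binomial expansion of `(1 + 4) ^ m` is small. -/
theorem sum_choose_mul_four_pow_le {m : ℕ} {δ : ℝ} (hδ : δ ≤ 1 / 10000) :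
    ∑ k ∈ range (m + 1), (if (k : ℝ) ≤ δ * m then (m.choose k : ℝ) * 4 ^ k else 0) ≤
      Real.exp (m / 256) := by
  have hexp : (4096 : ℝ) ≤ Real.exp 12 := by
    have : (2 : ℝ) ≤ Real.exp 1 := by linarith [Real.add_one_le_exp 1]
    calc (4096 : ℝ) = 2 ^ 12 := by norm_num
      _ ≤ Real.exp 1 ^ 12 := pow_le_pow_left₀ (by norm_num) this 12
      _ = _ := by rw [← Real.exp_nat_mul]; norm_num
  have hterm : ∀ k ∈ range (m + 1),
      (if (k : ℝ) ≤ δ * m then (m.choose k : ℝ) * 4 ^ k else 0) ≤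
        (m.choose k * (1 / 1024 : ℝ) ^ k) * Real.exp (12 * (δ * m)) := by
    intro k _
    split_ifs with h
    -- Splitting `4 = 4096/1024`: the powers of `4096` cost `e^(12δm)`, the remaining sum only
    -- `e^(m/1024)`.
    · have h1 : (4 : ℝ) ^ k = (1 / 1024 : ℝ) ^ k * 4096 ^ k := by
        rw [← mul_pow]; norm_num
      have h2 : (4096 : ℝ) ^ k ≤ Real.exp (12 * (δ * m)) := by
        refine (pow_le_pow_left₀ (by norm_num) hexp k).trans ?_
        rw [← Real.exp_nat_mul]
        exact Real.exp_le_exp.2 (by linarith)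
      rw [h1, mul_assoc]
      gcongr
    · positivity
  refine (Finset.sum_le_sum hterm).trans ?_
  rw [← Finset.sum_mul]
  refine (mul_le_mul_of_nonneg_right
    (sum_choose_mul_pow_le m (by norm_num)) (Real.exp_pos _).le).trans ?_
  rw [← Real.exp_add]
  have hm : (0 : ℝ) ≤ m := by positivity
  refine Real.exp_le_exp.2 ?_
  nlinarith

/-- With `x = m²/(4096N)`, the binomial theorem gives `e^(4m e^(-x))`, and `e^(-x) ≤ 1/x`. -/
theorem sum_choose_mul_four_pow_mul_exp_le {m : ℕ} (hm : 0 < m) {N : ℝ} (hN : 0 < N) :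
    ∑ k ∈ range (m + 1), (m.choose k : ℝ) * 4 ^ k * Real.exp (-(k * m ^ 2 / (4096 * N))) ≤
      Real.exp (16384 * (N / m)) := by
  have hm' : (0 : ℝ) < m := by exact_mod_cast hm
  set x : ℝ := m ^ 2 / (4096 * N) with hx
  have hx0 : 0 < x := by positivity
  have hex : Real.exp (-x) ≤ 1 / x := by
    rw [Real.exp_neg, one_div]
    exact inv_anti₀ hx0 (by linarith [Real.add_one_le_exp x])
  calc _ = ∑ k ∈ range (m + 1), (m.choose k : ℝ) * (4 * Real.exp (-x)) ^ k := by
        refine Finset.sum_congr rfl fun k _ => ?_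
        rw [mul_pow, ← Real.exp_nat_mul, mul_assoc, hx]
        ring_nf
    _ ≤ Real.exp (m * (4 * Real.exp (-x))) := sum_choose_mul_pow_le m (by positivity)
    _ ≤ Real.exp (m * (4 * (1 / x))) := by gcongr
    _ = _ := by congr 1; rw [hx]; field_simp; norm_num

/-! ### Summation over even parts. -/

theorem mem_sumFreeFewEven {n m : ℕ} {δ : ℝ} {I : Finset ℕ} :
    I ∈ sumFreeFewEven n m δ ↔ (I ⊆ Icc 1 n ∧ #I = m) ∧
      IsSumFree I ∧ (#(I \ oddsUpTo n) : ℝ) ≤ δ * m := by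
  simp [sumFreeFewEven]

/-- The number of sets in the family with a prescribed even part. -/
theorem card_sumFreeFewEven_fiber_le {n m : ℕ} {δ : ℝ} (hδ : δ ≤ 1 / 2) (hm : 8 ≤ m)
    (hmN : m ≤ (n + 1) / 2) {S : Finset ℕ} (hS : S ⊆ Icc 1 n \ oddsUpTo n) :
    (#{I ∈ sumFreeFewEven n m δ | I \ oddsUpTo n = S} : ℝ) ≤
      if (#S : ℝ) ≤ δ * m then ((n + 1) / 2).choose (m - #S) *
        (2 * Real.exp (-(m / 256)) + Real.exp (-(#S * m ^ 2 / (4096 * ((n + 1) / 2 : ℕ)))))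
      else 0 := by
  set N := (n + 1) / 2 with hN
  have hO : #(oddsUpTo n) = N := card_oddsUpTo n
  split_ifs with hSδ
  swap
  · rw [filter_false_of_mem, card_empty, Nat.cast_zero]
    rintro I hI rfl
    exact hSδ (mem_sumFreeFewEven.1 hI).2.2
  have hinj : #{I ∈ sumFreeFewEven n m δ | I \ oddsUpTo n = S} ≤
      #{R ∈ (oddsUpTo n).powersetCard (m - #S) | Disjoint R (R.biUnion (distances S))} := by
    refine card_le_card_of_injOn (fun I => I ∩ oddsUpTo n) (fun I hmem => ?_) fun I hI J hJ h => ?_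
    · obtain ⟨hF, rfl⟩ := mem_filter.1 (mem_coe.1 hmem)
      obtain ⟨⟨-, rfl⟩, hI, -⟩ := mem_sumFreeFewEven.1 hF
      refine mem_coe.2 (mem_filter.2 ⟨mem_powersetCard.2 ⟨inter_subset_right, ?_⟩,
        hI.disjoint_distances _⟩)
      have := card_sdiff_add_card_inter I (oddsUpTo n)
      change #(I ∩ oddsUpTo n) = _
      omega
    · rw [← sdiff_union_inter I (oddsUpTo n), ← sdiff_union_inter J (oddsUpTo n),
        (mem_filter.1 (mem_coe.1 hI)).2, (mem_filter.1 (mem_coe.1 hJ)).2]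
      exact congrArg _ h
  refine (Nat.cast_le.2 hinj).trans ?_
  have hm0 : (0 : ℝ) ≤ m := by positivity
  have hN0 : (0 : ℝ) < N := by exact_mod_cast (by omega : 0 < N)
  rcases Nat.eq_zero_or_pos #S with h0 | hk
  · have h1 := card_filter_le ((oddsUpTo n).powersetCard (m - #S))
      fun R => Disjoint R (R.biUnion (distances S))
    rw [card_powersetCard, hO] at h1
    refine (Nat.cast_le.2 h1).trans (le_mul_of_one_le_right (by positivity) ?_)
    rw [h0]
    simp only [CharP.cast_eq_zero, zero_mul, zero_div, neg_zero, Real.exp_zero]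
    linarith [Real.exp_pos (-(m / 256 : ℝ))]
  have hSm : 2 * #S ≤ m := by
    have : (2 * #S : ℝ) ≤ m := by nlinarith
    exact_mod_cast this
  -- The odd part has `r ≥ m/2 ≥ 4` elements, which turns `128` into `256` and `1024` into `4096`.
  have hr : (m : ℝ) / 2 ≤ (m - #S : ℕ) := by
    rw [div_le_iff₀ (by norm_num)]; exact_mod_cast (by omega : m ≤ (m - #S) * 2)
  refine (card_independent_le hk (fun v hv => distances_subset hS hv)
    (fun v _ => card_le_two_mul_card_image_dist S v)
    (fun w _ => card_mem_distances_le (oddsUpTo n) w) (by omega) (by omega)).trans ?_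
  rw [hO]
  refine mul_le_mul_of_nonneg_left (add_le_add (mul_le_mul_of_nonneg_left
    (Real.exp_le_exp.2 (by linarith)) (by norm_num)) (Real.exp_le_exp.2 (neg_le_neg ?_)))
    (by positivity)
  calc (#S * m ^ 2 / (4096 * N) : ℝ) = #S * (m / 2) ^ 2 / (1024 * N) := by
        field_simp; norm_num
    _ ≤ _ := by gcongr

theorem card_sumFreeFewEven_le_of_le {n m : ℕ} {δ : ℝ} (hδ : δ ≤ 1 / 10000) (hm : 8 ≤ m)
    (hmN : 4 * m ≤ 3 * ((n + 1) / 2)) :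
    (#(sumFreeFewEven n m δ) : ℝ) ≤
      ((n + 1) / 2).choose m * (2 + Real.exp (16384 * (((n + 1) / 2 : ℕ) / m))) := by
  set N := (n + 1) / 2 with hN
  set E := Icc 1 n \ oddsUpTo n with hE
  have hEc : #E ≤ N := by
    have := card_sdiff_of_subset (s := oddsUpTo n) (t := Icc 1 n) (filter_subset _ _)
    rw [← hE, card_oddsUpTo, Nat.card_Icc] at this
    omega
  have hN0 : (0 : ℝ) < N := by exact_mod_cast (by omega : 0 < N)
  have hm0 : (0 : ℝ) ≤ m := by positivity
  set g : ℕ → ℝ := fun k => 2 * Real.exp (-(m / 256)) + Real.exp (-(k * m ^ 2 / (4096 * N)))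
    with hg
  set f : ℕ → ℝ := fun k => if (k : ℝ) ≤ δ * m then N.choose (m - k) * g k else 0 with hf
  have hg0 : ∀ k, 0 ≤ g k := fun k => by positivity
  have hf0 : ∀ k, 0 ≤ f k := fun k => by
    simp only [hf]
    split_ifs
    · exact mul_nonneg (by positivity) (hg0 k)
    · exact le_rfl
  have hfm : ∀ k, m < k → f k = 0 := fun k hk => by
    have : (m : ℝ) < k := by exact_mod_cast hk
    exact if_neg (by nlinarith)
  have hfib : #(sumFreeFewEven n m δ) =
      ∑ S ∈ E.powerset, #{I ∈ sumFreeFewEven n m δ | I \ oddsUpTo n = S} :=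
    card_eq_sum_card_fiberwise fun I hI => mem_coe.2 <| mem_powerset.2 <|
      sdiff_subset_sdiff (mem_sumFreeFewEven.1 (mem_coe.1 hI)).1.1 le_rfl
  calc (#(sumFreeFewEven n m δ) : ℝ)
      = ∑ S ∈ E.powerset, (#{I ∈ sumFreeFewEven n m δ | I \ oddsUpTo n = S} : ℝ) := by
        exact_mod_cast hfib
    _ ≤ ∑ S ∈ E.powerset, f #S := Finset.sum_le_sum fun S hS =>
        card_sumFreeFewEven_fiber_le (by linarith) hm (by omega) (mem_powerset.1 hS)
    _ = ∑ k ∈ range (#E + 1), (#E).choose k * f k := by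
        rw [sum_powerset_apply_card]; simp only [nsmul_eq_mul]
    _ ≤ ∑ k ∈ range (N + 1), N.choose k * f k := by
        refine (Finset.sum_le_sum fun k _ => mul_le_mul_of_nonneg_right
          (Nat.cast_le.2 (Nat.choose_le_choose k hEc)) (hf0 k)).trans ?_
        exact Finset.sum_le_sum_of_subset_of_nonneg (range_subset_range.2 (by omega))
          fun k _ _ => mul_nonneg (by positivity) (hf0 k)
    _ = ∑ k ∈ range (m + 1), N.choose k * f k := by
        refine (Finset.sum_subset (range_subset_range.2 (by omega)) fun k _ hk => ?_).symm
        rw [hfm k (by simpa [Nat.lt_succ_iff] using hk), mul_zero]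
    _ ≤ ∑ k ∈ range (m + 1), N.choose m *
          (2 * Real.exp (-(m / 256)) * (if (k : ℝ) ≤ δ * m then (m.choose k : ℝ) * 4 ^ k else 0) +
            m.choose k * 4 ^ k * Real.exp (-(k * m ^ 2 / (4096 * N)))) := by
        refine Finset.sum_le_sum fun k hk => ?_
        have hkm : k ≤ m := by simpa [Nat.lt_succ_iff] using hk
        simp only [hf]
        split_ifs
        · have h : (N.choose k * N.choose (m - k) : ℝ) ≤ N.choose m * (m.choose k * 4 ^ k) := by
            exact_mod_cast choose_mul_choose_sub_le hkm hmN
          calc _ = (N.choose k * N.choose (m - k) : ℝ) * g k := by ring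
            _ ≤ N.choose m * (m.choose k * 4 ^ k) * g k := mul_le_mul_of_nonneg_right h (hg0 k)
            _ = _ := by rw [hg]; ring
        · rw [mul_zero]; positivity
    _ ≤ _ := by
        rw [← Finset.mul_sum, Finset.sum_add_distrib, ← Finset.mul_sum]
        refine mul_le_mul_of_nonneg_left (add_le_add ?_
          (sum_choose_mul_four_pow_mul_exp_le (by omega) hN0)) (by positivity)
        refine (mul_le_mul_of_nonneg_left (sum_choose_mul_four_pow_le hδ)
          (by positivity)).trans_eq ?_
        -- The factor `e^(-m/256)` exactly cancels the sum over `k ≤ δm`.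
        rw [mul_assoc, ← Real.exp_add, neg_add_cancel, Real.exp_zero, mul_one]

/-- If `m` is large, a sum-free set in the family has only odd elements. -/
theorem card_sumFreeFewEven_le_choose {n m : ℕ} {δ : ℝ} (hδ : δ ≤ 1 / 10000)
    (h : m < 8 ∨ 3 * ((n + 1) / 2) < 4 * m) :
    #(sumFreeFewEven n m δ) ≤ ((n + 1) / 2).choose m := by
  rw [← card_oddsUpTo, ← card_powersetCard]
  refine card_le_card fun I hI => ?_
  obtain ⟨⟨hIn, hIm⟩, hI, hIδ⟩ := mem_sumFreeFewEven.1 hI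
  refine mem_powersetCard.2 ⟨sdiff_eq_empty_iff_subset.1 (not_nonempty_iff_eq_empty.1 ?_), hIm⟩
  intro hne
  have hm0 : (0 : ℝ) ≤ m := by positivity
  have h1 : 10000 * #(I \ oddsUpTo n) ≤ m := by
    have : (10000 * #(I \ oddsUpTo n) : ℝ) ≤ m := by nlinarith
    exact_mod_cast this
  have h2 := hne.card_pos
  have h3 := hI.three_mul_card_odds_le hIn hne
  have h4 := card_sdiff_add_card_inter I (oddsUpTo n)
  rw [card_oddsUpTo] at h3
  -- For `m < 8` an even element contradicts `h1`; otherwise `3(m - m/10000) ≤ 2N` contradicts `3N <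
  -- 4m`.
  omega

theorem proposition4p1 :
    ∃ δ₀ : ℝ, 0 < δ₀ ∧ ∃ C : ℝ, 0 < C ∧
      ∀ δ : ℝ, 0 < δ → δ ≤ δ₀ → ∀ n m : ℕ, 1 ≤ n → 1 ≤ m →
        ((sumFreeFewEven n m δ).card : ℝ) ≤
          (2 : ℝ) ^ (C * ((n : ℝ) / (m : ℝ))) * (((n + 1) / 2).choose m : ℝ) := by
  refine ⟨1 / 10000, by norm_num, 40000, by norm_num, fun δ _ hδ n m hn hm => ?_⟩
  have hm0 : (0 : ℝ) < m := by exact_mod_cast hm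
  set t : ℝ := n / m with ht
  have ht0 : 0 ≤ t := by positivity
  rw [mul_comm]
  by_cases h : m < 8 ∨ 3 * ((n + 1) / 2) < 4 * m
  · exact (Nat.cast_le.2 (card_sumFreeFewEven_le_choose hδ h)).trans
      (le_mul_of_one_le_right (by positivity)
        (Real.one_le_rpow (by norm_num) (by positivity)))
  rw [not_or, not_lt, not_lt] at h
  refine (card_sumFreeFewEven_le_of_le hδ h.1 h.2).trans
    (mul_le_mul_of_nonneg_left ?_ (by positivity))
  have ht1 : 1 ≤ t := by
    rw [ht, one_le_div hm0]; exact_mod_cast (by omega : m ≤ n)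
  have hNt : (((n + 1) / 2 : ℕ) / m : ℝ) ≤ t := by
    have : (((n + 1) / 2 : ℕ) : ℝ) ≤ n := by exact_mod_cast (by omega : (n + 1) / 2 ≤ n)
    rw [ht]; gcongr
  have h1 : Real.exp (16384 * (((n + 1) / 2 : ℕ) / m)) ≤ Real.exp (16384 * t) :=
    Real.exp_le_exp.2 (by linarith)
  have h2 : (2 : ℝ) ≤ Real.exp t := by linarith [Real.add_one_le_exp t]
  have h3 : Real.exp (16384 * t) ≤ Real.exp (18000 * t) := Real.exp_le_exp.2 (by linarith)
  have h4 : Real.exp t ≤ Real.exp (18000 * t) := Real.exp_le_exp.2 (by linarith)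
  rw [Real.rpow_def_of_pos (by norm_num)]
  -- The factor `e^t ≥ 2` absorbs the summand `2`, and `18001 < 40000 log 2`.
  have h5 : Real.exp t * Real.exp (18000 * t) ≤ Real.exp (Real.log 2 * (40000 * t)) := by
    rw [← Real.exp_add]
    refine Real.exp_le_exp.2 ?_
    nlinarith [Real.log_two_gt_d9]
  nlinarith
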